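/- Fix $n\in\mathbb N\cup\{\infty\}$. A *Whitney stratification* of an open set $M\subseteq\mathbb R^k$ is a locally finite decomposition of $M$ into disjoint connected locally closed smooth submanifolds (strata) such that a stratum meeting the closure $\overline T$ of a stratum $T$ is contained in $\overline T$, and such that Whitney's condition B holds for every pair of strata. A *compact stratified space* is a compact set $X\subseteq\mathbb R^k$ which is a union of strata of a Whitney stratification of an open neighbourhood of $X$; it is *cellular* if its strata are contractible. A map $f:X\to Y$ of compact stratified spaces is *smooth* if it extends to a smooth map on a neighbourhood of $X$ in the ambient Euclidean space. A smooth map is *stratified* if the preimage of each stratum $B$ of $Y$ is a union of strata of $X$, and $f|_A:A\to B$ is a submersion for each stratum $A\subseteq f^{-1}B$. It is *prestratified* if it becomes stratified when the stratification of $X$ is replaced by some subdivision, i.e. a Whitney stratification of the same underlying space each of whose strata lies in a stratum of $X$. Let $\mathrm{Strat}_n$ be the category whose objects are the compact cellular stratified spaces of dimension $\le n$ and whose morphisms are the stratified maps modulo smooth homotopy $h:X\times[0,1]\to Y$ through stratified maps, with $h(x,t)=h(x,0)$ for all $t$ whenever $x$ lies in a stratum of dimension $<n$. Let $\mathrm{PreStrat}_n$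 be the category with the same objects whose morphisms are the finite composites (through such objects) of prestratified maps, modulo the same kind of homotopy through finite composites of prestratified maps. There is an evident functor $\mathrm{Strat}_n\to\mathrm{PreStrat}_n$. A stratified map $f:Y\to X$ *trivially covers* a stratum $A$ of $X$ if $f^{-1}A$ is a single stratum and $f|_{f^{-1}A}:f^{-1}A\to A$ is a diffeomorphism. A sieve on $X$ in $\mathrm{Strat}_n$ is *covering* if for each stratum $A$ of $X$ it contains (the class of) a stratified map trivially covering $A$. A presheaf of sets on $\mathrm{Strat}_n$ is a *sheaf* if every matching family on every covering sieve has a unique amalgamation. A *Whitney $n$-category* is a presheaf of sets on $\mathrm{PreStrat}_n$ whose restriction to $\mathrm{Strat}_n$ is a sheaf. Let $\iota:\mathrm{Whit}_n\hookrightarrow\mathrm{PSh}(\mathrm{PreStrat}_n)$ be the full subcategory of Whitney $n$-categories. **Theorem.** 1. $\mathrm{Whit}_n$ is complete (has all small limits), and limits are computed objectwise. That is, for a small diagram $i\mapsto\mathcal A_i$ in $\mathrm{Whit}_n$, the presheaf $X\mapsto\lim_i(\mathcal A_i(X))$ is a Whitney $n$-category, and a cone on the diagram in $\mathrm{Whit}_n$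 is a limit cone if and only if its evaluation at every $X$ is a limit cone of sets. 2. The inclusion $\iota$ has a left adjoint $\omega$. 3. $\mathrm{Whit}_n$ is cocomplete (has all small colimits), and $\operatorname{colim}_i\mathcal A_i\cong\omega(\operatorname{colim}_i\iota\mathcal A_i)$, where the right hand colimit is the colimit of presheaves. More precisely, $\omega(\operatorname{colim}_i\iota\mathcal A_i)$ with the maps $\mathcal A_i\to\operatorname{colim}_i\iota\mathcal A_i\to\omega(\operatorname{colim}_i\iota\mathcal A_i)$, the second being the unit of the adjunction, is a colimit of the diagram in $\mathrm{Whit}_n$. -/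

import Mathlib

open CategoryTheory Limits Topology Filter Set
open scoped ContDiff

noncomputable section

namespace Whitney

/-- Euclidean `k`-space. -/
abbrev E (k : ℕ) : Type := EuclideanSpace ℝ (Fin k)

/-- The tangent space at `x` of a submanifold `S` of Euclidean space: for a smooth submanifold the
tangent cone is already a linear subspace. -/
def tangentSpace {k : ℕ} (S : Set (E k)) (x : E k) : Submodule ℝ (E k) :=
  Submodule.span ℝ (tangentConeAt ℝ S x)

/-- `S` is a (locally closed) smooth `d`-dimensional submanifold of Euclidean `k`-space: near each
of its points a diffeomorphism between open sets of `E k` carries `S` to a `d`-dimensional linear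
subspace. -/
def IsSubmanifold {k : ℕ} (d : ℕ) (S : Set (E k)) : Prop :=
  ∀ x ∈ S, ∃ (φ : OpenPartialHomeomorph (E k) (E k)) (V : Submodule ℝ (E k)),
    x ∈ φ.source ∧ ContDiffOn ℝ ∞ φ φ.source ∧ ContDiffOn ℝ ∞ φ.symm φ.target ∧
    Module.finrank ℝ V = d ∧ ∀ y ∈ φ.source, y ∈ S ↔ φ y ∈ V

/-- Convergence of linear subspaces in the Grassmannian, with a subspace identified with the
orthogonal projection onto it. -/
def SubspaceTendsto {k : ℕ} (V : ℕ → Submodule ℝ (E k)) (W : Submodule ℝ (E k)) : Prop :=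
  Tendsto (fun i => (V i).starProjection) atTop (𝓝 W.starProjection)

/-- The Whitney B condition for a pair of submanifolds `S`, `T`. -/
def WhitneyB {k : ℕ} (S T : Set (E k)) : Prop :=
  ∀ x ∈ S, ∀ a b : ℕ → E k, (∀ i, a i ∈ S) → (∀ i, b i ∈ T) →
    Tendsto a atTop (𝓝 x) → Tendsto b atTop (𝓝 x) →
    ∀ L P : Submodule ℝ (E k),
      SubspaceTendsto (fun i => Submodule.span ℝ {b i - a i}) L →
      SubspaceTendsto (fun i => tangentSpace T (b i)) P → L ≤ P

/-- `𝒮` is (the set of strata of) a Whitney stratification of the open submanifold `M` of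
Euclidean space. The partial order on the strata is the closure relation. -/
structure IsWhitneyStratification {k : ℕ} (M : Set (E k)) (𝒮 : Set (Set (E k))) : Prop where
  isOpen : IsOpen M
  sUnion_eq : ⋃₀ 𝒮 = M
  pairwiseDisjoint : 𝒮.PairwiseDisjoint id
  locallyFinite : ∀ x ∈ M, ∃ U ∈ 𝓝 x, {S ∈ 𝒮 | (S ∩ U).Nonempty}.Finite
  frontier : ∀ S ∈ 𝒮, ∀ T ∈ 𝒮, (S ∩ closure T).Nonempty → S ⊆ closure T
  isConnected : ∀ S ∈ 𝒮, IsConnected S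
  isSubmanifold : ∀ S ∈ 𝒮, ∃ d, IsSubmanifold d S
  whitneyB : ∀ S ∈ 𝒮, ∀ T ∈ 𝒮, S ≠ T → WhitneyB S T

/-- `X`, with strata `𝒮`, is a compact Whitney stratified subspace: a compact union of strata in a
Whitney stratification of an open neighbourhood of `X` in Euclidean space. -/
def IsCompactStratified {k : ℕ} (X : Set (E k)) (𝒮 : Set (Set (E k))) : Prop :=
  IsCompact X ∧ ⋃₀ 𝒮 = X ∧ ∃ M 𝒯, IsWhitneyStratification M 𝒯 ∧ 𝒮 ⊆ 𝒯

/-- Compact cellular stratified spaces of dimension at most `n`. -/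
structure Space (n : ℕ∞) : Type where
  /-- the dimension of the ambient Euclidean space -/
  ambient : ℕ
  /-- the underlying space -/
  carrier : Set (E ambient)
  /-- the strata -/
  strata : Set (Set (E ambient))
  stratified : IsCompactStratified carrier strata
  cellular : ∀ S ∈ strata, ContractibleSpace S
  dim_le : ∀ S ∈ strata, ∃ d : ℕ, IsSubmanifold d S ∧ (d : ℕ∞) ≤ n

/-- `F`, on the open set `U`, is a smooth extension of the map `f : X → Y`. -/
def IsExtension {k l : ℕ} {X : Set (E k)} {Y : Set (E l)} (f : X → Y)
    (U : Set (E k)) (F : E k → E l) : Prop :=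
  IsOpen U ∧ X ⊆ U ∧ ContDiffOn ℝ ∞ F U ∧ ∀ x : X, F x = f x

/-- Smooth maps: maps of the underlying spaces which extend to a smooth map of neighbourhoods in
the ambient Euclidean spaces. -/
@[ext]
structure SmoothMap {n : ℕ∞} (X Y : Space n) : Type where
  /-- the underlying map -/
  toFun : X.carrier → Y.carrier
  smooth : ∃ U F, IsExtension toFun U F

/-- `f : X → Y` is a stratified submersion for the strata `𝒮` of `X` and `𝒯` of `Y`: preimages of
strata are unions of strata, and `f` restricts to a submersion `A → B` whenever the stratum `A`
lies over the stratum `B`. -/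
def IsStratifiedMap {k l : ℕ} {X : Set (E k)} {Y : Set (E l)}
    (𝒮 : Set (Set (E k))) (𝒯 : Set (Set (E l))) (f : X → Y) : Prop :=
  (∀ B ∈ 𝒯, ∃ 𝒜 ⊆ 𝒮, ∀ x : X, (f x : E l) ∈ B ↔ (x : E k) ∈ ⋃₀ 𝒜) ∧
  ∃ U F, IsExtension f U F ∧
    ∀ A ∈ 𝒮, ∀ B ∈ 𝒯, (∀ x : X, (x : E k) ∈ A → (f x : E l) ∈ B) →
      ∀ x ∈ A, (tangentSpace A x).map (fderiv ℝ F x).toLinearMap = tangentSpace B (F x)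

/-- `𝒮'` is a subdivision of the stratification `𝒮` of `X`. -/
def IsSubdivision {k : ℕ} (X : Set (E k)) (𝒮' 𝒮 : Set (Set (E k))) : Prop :=
  IsCompactStratified X 𝒮' ∧ ∀ S' ∈ 𝒮', ∃ S ∈ 𝒮, S' ⊆ S

theorem IsCompactStratified.nonempty {k : ℕ} {X : Set (E k)} {𝒮 : Set (Set (E k))}
    (h : IsCompactStratified X 𝒮) {S : Set (E k)} (hS : S ∈ 𝒮) : S.Nonempty := by
  obtain ⟨_, _, M, 𝒯, hM, hT⟩ := h
  exact (hM.isConnected S (hT hS)).nonempty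

theorem IsCompactStratified.eq_of_mem {k : ℕ} {X : Set (E k)} {𝒮 : Set (Set (E k))}
    (h : IsCompactStratified X 𝒮) {S T : Set (E k)} (hS : S ∈ 𝒮) (hT : T ∈ 𝒮) {x : E k}
    (hxS : x ∈ S) (hxT : x ∈ T) : S = T := by
  obtain ⟨_, _, M, 𝒯, hM, hh⟩ := h
  exact hM.pairwiseDisjoint.elim (hh hS) (hh hT) (Set.not_disjoint_iff.2 ⟨x, hxS, hxT⟩)

theorem IsExtension.id {k : ℕ} (X : Set (E k)) :
    IsExtension (fun x : X => x) Set.univ (fun x => x) :=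
  ⟨isOpen_univ, subset_univ _, contDiffOn_id, fun _ => rfl⟩

theorem IsExtension.comp {k l m : ℕ} {X : Set (E k)} {Y : Set (E l)} {Z : Set (E m)}
    {f : X → Y} {g : Y → Z} {U : Set (E k)} {V : Set (E l)} {F : E k → E l} {G : E l → E m}
    (hf : IsExtension f U F) (hg : IsExtension g V G) :
    IsExtension (fun x => g (f x)) (U ∩ F ⁻¹' V) (G ∘ F) := by
  obtain ⟨hU, hXU, hF, hFf⟩ := hf
  obtain ⟨hV, hYV, hG, hGg⟩ := hg
  refine ⟨hF.continuousOn.isOpen_inter_preimage hU hV, fun x hx => ⟨hXU hx, ?_⟩, ?_, fun x => ?_⟩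
  · have := hFf ⟨x, hx⟩
    simp only at this
    exact hYV (by rw [this]; exact (f ⟨x, hx⟩).2)
  · exact hG.comp (hF.mono inter_subset_left) (fun x hx => hx.2)
  · simp [hFf, hGg]

/-- The category of compact cellular stratified spaces of dimension at most `n` and all smooth
maps between them. -/
instance smoothCategory (n : ℕ∞) : Category (Space n) where
  Hom X Y := SmoothMap X Y
  id X := ⟨fun x => x, _, _, IsExtension.id X.carrier⟩
  comp f g := ⟨fun x => g.toFun (f.toFun x), by
    obtain ⟨U, F, hF⟩ := f.smooth
    obtain ⟨V, G, hG⟩ := g.smooth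
    exact ⟨_, _, hF.comp hG⟩⟩

/-- Stratified maps. -/
def stratifiedMaps (n : ℕ∞) : MorphismProperty (Space n) :=
  fun X Y f => IsStratifiedMap X.strata Y.strata (SmoothMap.toFun f)

/-- Prestratified maps: smooth maps which become stratified after some subdivision of the
source. -/
def prestratifiedMaps (n : ℕ∞) : MorphismProperty (Space n) :=
  fun X Y f => ∃ 𝒮', IsSubdivision X.carrier 𝒮' X.strata ∧
    IsStratifiedMap 𝒮' Y.strata (SmoothMap.toFun f)

/-- Finite composites of prestratified maps: the smallest class of smooth maps which contains the
prestratified maps and is closed under composition. -/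
abbrev prestratifiedComposites (n : ℕ∞) : MorphismProperty (Space n) :=
  (prestratifiedMaps n).multiplicativeClosure

instance stratifiedMaps_isMultiplicative (n : ℕ∞) : (stratifiedMaps n).IsMultiplicative where
  id_mem X := by
    refine ⟨fun B hB => ⟨{B}, by simpa using hB, fun x => ?_⟩, Set.univ, fun x => x,
      IsExtension.id X.carrier, fun A hA B hB h x hx => ?_⟩
    · simp only [sUnion_singleton]; exact Iff.rfl
    · have hxX : x ∈ X.carrier := by rw [← X.stratified.2.1]; exact ⟨A, hA, hx⟩
      have hAB : A = B := X.stratified.eq_of_mem hA hB hx (h ⟨x, hxX⟩ hx)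
      subst hAB
      rw [show fderiv ℝ (fun x : E X.ambient => x) x = ContinuousLinearMap.id ℝ _ from fderiv_fun_id]
      exact Submodule.map_id _
  comp_mem {X Y Z} f g hf hg := by
    obtain ⟨hf1, U, F, hF, hf2⟩ := hf
    obtain ⟨hg1, V, G, hG, hg2⟩ := hg
    refine ⟨fun C hC => ?_, _, _, hF.comp hG, fun A hA C hC h x hx => ?_⟩
    · obtain ⟨ℬ, hℬ, hB⟩ := hg1 C hC
      refine ⟨{A ∈ X.strata | ∃ B ∈ ℬ, ∃ x : X.carrier, (x : E _) ∈ A ∧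
        ((SmoothMap.toFun f x : Y.carrier) : E _) ∈ B}, fun A hA => hA.1, fun x => ?_⟩
      change ((SmoothMap.toFun g (SmoothMap.toFun f x) : Z.carrier) : E _) ∈ C ↔ _
      rw [hB]
      constructor
      · rintro ⟨B, hBB, hxB⟩
        have hx : (x : E _) ∈ ⋃₀ X.strata := by rw [X.stratified.2.1]; exact x.2
        obtain ⟨A, hA, hxA⟩ := hx
        exact ⟨A, ⟨hA, B, hBB, x, hxA, hxB⟩, hxA⟩
      · rintro ⟨A, ⟨hA, B, hBB, y, hyA, hyB⟩, hxA⟩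
        obtain ⟨𝒜, h𝒜, hh⟩ := hf1 B (hℬ hBB)
        obtain ⟨A', hA', hyA'⟩ := (hh y).1 hyB
        have := X.stratified.eq_of_mem hA (h𝒜 hA') hyA hyA'
        exact ⟨B, hBB, (hh x).2 ⟨A', hA', this ▸ hxA⟩⟩
    · have hxX : x ∈ X.carrier := by rw [← X.stratified.2.1]; exact ⟨A, hA, hx⟩
      have hy : ((SmoothMap.toFun f ⟨x, hxX⟩ : Y.carrier) : E _) ∈ ⋃₀ Y.strata := by
        rw [Y.stratified.2.1]; exact (SmoothMap.toFun f ⟨x, hxX⟩).2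
      obtain ⟨B, hB, hyB⟩ := hy
      have hAB : ∀ z : X.carrier, (z : E _) ∈ A →
          ((SmoothMap.toFun f z : Y.carrier) : E _) ∈ B := by
        intro z hz
        obtain ⟨𝒜, h𝒜, hh⟩ := hf1 B hB
        obtain ⟨A', hA', hxA'⟩ := (hh ⟨x, hxX⟩).1 hyB
        have := X.stratified.eq_of_mem hA (h𝒜 hA') hx hxA'
        exact (hh z).2 ⟨A', hA', this ▸ hz⟩
      have hBC : ∀ z : Y.carrier, (z : E _) ∈ B →
          ((SmoothMap.toFun g z : Z.carrier) : E _) ∈ C := by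
        intro z hz
        obtain ⟨ℬ, hℬ, hh⟩ := hg1 C hC
        obtain ⟨B', hB', hyB'⟩ := (hh _).1 (h ⟨x, hxX⟩ hx)
        have := Y.stratified.eq_of_mem hB (hℬ hB') hyB hyB'
        exact (hh z).2 ⟨B', hB', this ▸ hz⟩
      have e1 := hf2 A hA B hB hAB x hx
      have hFx : F x = (SmoothMap.toFun f ⟨x, hxX⟩ : Y.carrier) := hF.2.2.2 ⟨x, hxX⟩
      have hFB : F x ∈ B := by rw [hFx]; exact hyB
      have e2 := hg2 B hB C hC hBC (F x) hFB
      have hFY : F x ∈ Y.carrier := by rw [hFx]; exact (SmoothMap.toFun f ⟨x, hxX⟩).2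
      have dF : DifferentiableAt ℝ F x :=
        (hF.2.2.1.contDiffAt (hF.1.mem_nhds (hF.2.1 hxX))).differentiableAt (by simp)
      have dG : DifferentiableAt ℝ G (F x) :=
        (hG.2.2.1.contDiffAt (hG.1.mem_nhds (hG.2.1 hFY))).differentiableAt (by simp)
      rw [fderiv_comp x dG dF]
      change Submodule.map ((fderiv ℝ G (F x)).toLinearMap ∘ₗ (fderiv ℝ F x).toLinearMap) _ = _
      rw [Submodule.map_comp, e1, e2]
      rfl

theorem stratifiedMaps_le (n : ℕ∞) : stratifiedMaps n ≤ prestratifiedComposites n :=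
  fun X _ _ hf => .of _ ⟨X.strata, ⟨X.stratified, fun S hS => ⟨S, hS, subset_rfl⟩⟩, hf⟩

/-- Homotopy of maps through maps in the class `P`, relative to strata of dimension `< n`. The
homotopy is smooth: it extends smoothly to a neighbourhood of `X × [0,1]`. -/
def homotopyRel (n : ℕ∞) (P : MorphismProperty (Space n)) [P.IsMultiplicative] :
    HomRel (WideSubcategory P) := fun X Y f g =>
  ∃ h : unitInterval → (X.obj ⟶ Y.obj), h 0 = f.hom ∧ h 1 = g.hom ∧ (∀ t, P (h t)) ∧
    (∃ (U : Set (E X.obj.ambient × ℝ)) (H : E X.obj.ambient × ℝ → E Y.obj.ambient),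
      IsOpen U ∧ X.obj.carrier ×ˢ unitInterval ⊆ U ∧ ContDiffOn ℝ ∞ H U ∧
      ∀ (x : X.obj.carrier) (t : unitInterval),
        H ((x : E X.obj.ambient), (t : ℝ)) = (SmoothMap.toFun (h t) x : Y.obj.carrier)) ∧
    ∀ S ∈ X.obj.strata, (∃ d : ℕ, IsSubmanifold d S ∧ (d : ℕ∞) < n) →
      ∀ x : X.obj.carrier, (x : E X.obj.ambient) ∈ S →
        ∀ t, SmoothMap.toFun (h t) x = SmoothMap.toFun (h 0) x

/-- The category `Strat_n` of homotopy classes of stratified maps. (`Quotient` divides by the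
congruence generated by homotopy; composing a homotopy with a map on either side is again a
homotopy.) -/
abbrev Strat (n : ℕ∞) : Type := CategoryTheory.Quotient (homotopyRel n (stratifiedMaps n))

/-- The category `PreStrat_n` of homotopy classes of (composites of) prestratified maps. -/
abbrev PreStrat (n : ℕ∞) : Type :=
  CategoryTheory.Quotient (homotopyRel n (prestratifiedComposites n))

/-- Stratified maps regarded as prestratified maps. -/
def stratifiedToPrestratified (n : ℕ∞) :
    WideSubcategory (stratifiedMaps n) ⥤ WideSubcategory (prestratifiedComposites n) where
  obj X := ⟨X.obj⟩
  map f := ⟨f.hom, stratifiedMaps_le n _ f.property⟩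

/-- The functor `Strat_n ⥤ PreStrat_n`, the identity on objects. -/
def stratToPreStrat (n : ℕ∞) : Strat n ⥤ PreStrat n :=
  CategoryTheory.Quotient.lift _
    (stratifiedToPrestratified n ⋙ CategoryTheory.Quotient.functor _) (by
      rintro X Y f g ⟨h, h0, h1, hP, hH, hrel⟩
      exact CategoryTheory.Quotient.sound _
        ⟨h, h0, h1, fun t => stratifiedMaps_le n _ (hP t), hH, hrel⟩)

/-- The stratified map `f : Y ⟶ X` trivially covers the stratum `A` of `X`: the preimage of `A` is
a single stratum `B`, and `f` restricts to a diffeomorphism `B → A`, with smooth inverse `g`. -/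
def TriviallyCovers {n : ℕ∞} {Y X : WideSubcategory (stratifiedMaps n)} (f : Y ⟶ X)
    (A : Set (E X.obj.ambient)) : Prop :=
  ∃ B ∈ Y.obj.strata,
    (∀ y : Y.obj.carrier, (SmoothMap.toFun f.hom y : E X.obj.ambient) ∈ A ↔
      (y : E Y.obj.ambient) ∈ B) ∧
    (∀ a ∈ A, ∃ y : Y.obj.carrier, (SmoothMap.toFun f.hom y : E X.obj.ambient) = a) ∧
    ∃ (U : Set (E X.obj.ambient)) (g : E X.obj.ambient → E Y.obj.ambient),
      IsOpen U ∧ A ⊆ U ∧ ContDiffOn ℝ ∞ g U ∧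
      ∀ y : Y.obj.carrier, (y : E Y.obj.ambient) ∈ B → g (SmoothMap.toFun f.hom y) = y

/-- Covering sieves in `Strat_n`: for each stratum there is a map in the sieve trivially covering
that stratum. -/
def IsCoveringSieve {n : ℕ∞} {X : Strat n} (R : Sieve X) : Prop :=
  ∀ A ∈ X.as.obj.strata, ∃ (Y : WideSubcategory (stratifiedMaps n)) (f : Y ⟶ X.as),
    TriviallyCovers f A ∧ R.arrows ((CategoryTheory.Quotient.functor _).map f)

/-- A presheaf on `Strat_n` is a sheaf if each matching family for a covering sieve has a unique
amalgamation. -/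
def IsStratSheaf {n : ℕ∞} (A : (Strat n)ᵒᵖ ⥤ Type) : Prop :=
  ∀ (X : Strat n) (R : Sieve X), IsCoveringSieve R → Presieve.IsSheafFor A R.arrows

/-- Whitney `n`-categories among presheaves on `PreStrat_n`. -/
def isWhitneyCategory (n : ℕ∞) : ObjectProperty ((PreStrat n)ᵒᵖ ⥤ Type) :=
  fun A => IsStratSheaf ((stratToPreStrat n).op ⋙ A)

/-- The category `Whit_n` of Whitney `n`-categories. -/
abbrev Whit (n : ℕ∞) := (isWhitneyCategory n).FullSubcategory

/-- The inclusion of `Whit_n` into the presheaves on `PreStrat_n`. -/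
abbrev inclusion (n : ℕ∞) : Whit n ⥤ ((PreStrat n)ᵒᵖ ⥤ Type) := (isWhitneyCategory n).ι

/-- A cone of presheaves on `PreStrat_n` is an objectwise limit if at each `X` it becomes a limit
cone of sets. -/
def IsObjectwiseLimit {n : ℕ∞} {J : Type} [SmallCategory J]
    {D : J ⥤ ((PreStrat n)ᵒᵖ ⥤ Type)} (c : Cone D) : Prop :=
  ∀ X : (PreStrat n)ᵒᵖ, Nonempty (IsLimit (((evaluation (PreStrat n)ᵒᵖ Type).obj X).mapCone c))

/-- Given a left adjoint `Om` of the inclusion, the cocone on a diagram `D` of Whitney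
`n`-categories obtained by applying `Om` to a cocone `c` of presheaves on `D`: its point is
`Om c.pt`, and its legs are the legs of `c` followed by the unit `c.pt ⟶ Om c.pt`. -/
def omegaCocone {n : ℕ∞} {Om : ((PreStrat n)ᵒᵖ ⥤ Type) ⥤ Whit n} (adj : Om ⊣ inclusion n)
    {J : Type} [SmallCategory J] {D : J ⥤ Whit n} (c : Cocone (D ⋙ inclusion n)) : Cocone D where
  pt := Om.obj c.pt
  ι :=
    { app := fun j => ObjectProperty.homMk (c.ι.app j ≫ adj.unit.app c.pt)
      naturality := fun i j u => by
        apply ObjectProperty.hom_ext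
        have h := c.w u
        dsimp at h ⊢
        rw [← Category.assoc, h]
        simp }

end Whitney

end

/-! The argument is formal and uses no geometry of stratified spaces: only that `Strat n` and
`PreStrat n` are small and that the covering sieves form a set. The sheaf condition for a sieve on
`X` says that its inclusion into the representable of `X` is orthogonal to the restricted presheaf.
By the adjunction between left Kan extension and restriction, this is orthogonality of the presheaf
on `PreStrat n` to the Kan-extended inclusion (`isSheafFor_comp_iff`). So `Whit n` is the class of
objects orthogonal to a small set of morphisms in a locally presentable category. Such a class is
closed under limits, and the orthogonal subcategory theorem makes it reflective; colimits are then
reflections of presheaf colimits. -/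

namespace Whitney

open CategoryTheory Limits Opposite

universe w v u

/-! ### Reflectivity of small orthogonality classes -/

/-- A small family of presentable objects is uniformly `κ`-presentable for a single `κ`. -/
theorem exists_isCardinalPresentable {C : Type u} [Category.{v} C] {ι : Type w} (X : ι → C)
    [∀ i, IsPresentable.{w} (X i)] :
    ∃ (κ : Cardinal.{w}) (_ : Fact κ.IsRegular), ∀ i, IsCardinalPresentable (X i) κ := by
  choose κ hκ h using fun i =>
    Functor.IsAccessible.exists_cardinal (F := coyoneda.obj (op (X i)))
  -- Joining with `ℵ₀` makes the cardinal infinite, so that its successor is regular.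
  let μ : Cardinal.{w} := Order.succ (iSup κ ⊔ Cardinal.aleph0)
  have hμ : Fact μ.IsRegular := ⟨Cardinal.isRegular_succ le_sup_right⟩
  refine ⟨μ, hμ, fun i => ?_⟩
  have := hκ i
  have : IsCardinalPresentable (X i) (κ i) := h i
  refine isCardinalPresentable_of_le (X i) (κ := κ i) ?_
  exact (le_ciSup (Cardinal.bddAbove_of_small) i).trans
    (le_sup_left.trans (Order.le_succ _))

/-- The inclusion of the objects local for a small set of morphisms in a locally presentable
category is a right adjoint. -/
theorem isRightAdjoint_ι_isLocal_of_isSmall {C : Type u} [Category.{v} C]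
    [IsLocallyPresentable.{w} C] [LocallySmall.{w} C] [HasColimitsOfSize.{w, w} C]
    {ι : Type w} {A B : ι → C} (f : ∀ i, A i ⟶ B i) :
    (MorphismProperty.ofHoms f).isLocal.ι.IsRightAdjoint := by
  -- The orthogonal subcategory theorem asks for one `κ` serving all sources and all targets.
  obtain ⟨κ, _, hκ⟩ := exists_isCardinalPresentable (Sum.elim A B)
  exact MorphismProperty.isRightAdjoint_ι_isLocal _ κ (fun _ _ _ ⟨i⟩ =>
    ⟨hκ (.inl i), hκ (.inr i)⟩)

/-! ### The sheaf condition as orthogonality -/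

/-- The presheaves whose restriction along `F` satisfies the sheaf condition for the sieve `R` are
those which are local for the left Kan extension of the inclusion of `R`. -/
theorem isSheafFor_comp_iff {C D : Type} [SmallCategory C] [SmallCategory D] (F : C ⥤ D)
    {X : C} (R : Sieve X) (P : Dᵒᵖ ⥤ Type) :
    Presieve.IsSheafFor (F.op ⋙ P) R.arrows ↔
      Function.Bijective
        (fun g : F.op.lan.obj (yoneda.obj X) ⟶ P => F.op.lan.map R.functorInclusion ≫ g) := by
  rw [Presieve.isSheafFor_iff_yonedaSheafCondition, Presieve.YonedaSheafCondition,
    ← Function.bijective_iff_existsUnique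
      (fun g : yoneda.obj X ⟶ F.op ⋙ P => R.functorInclusion ≫ g)]
  let adj := F.op.lanAdjunction (Type)
  -- Composing with the adjunction bijections turns both sides into maps from `F.op.lan.obj
  -- (yoneda.obj X) ⟶ P` to `R.functor ⟶ F.op ⋙ P`; they agree by naturality of the adjunction.
  rw [← Function.Bijective.of_comp_iff' (adj.homEquiv R.functor P).bijective,
    ← Function.Bijective.of_comp_iff _ (adj.homEquiv (yoneda.obj X) P).bijective]
  refine iff_of_eq (congrArg _ (funext fun g => ?_))
  exact (adj.homEquiv_naturality_left _ _).symm

/-- The inclusions of the sieves satisfying `K`, extended along `F` to presheaves. -/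
noncomputable def lanSieveInclusion {C D : Type} [SmallCategory C] [SmallCategory D] (F : C ⥤ D)
    (K : ∀ X : C, Sieve X → Prop) (i : Σ X : C, {R : Sieve X // K X R}) :
    F.op.lan.obj i.2.1.functor ⟶ F.op.lan.obj (yoneda.obj i.1) :=
  F.op.lan.map i.2.1.functorInclusion

/-- `K` need not be a Grothendieck topology: each sieve contributes its own orthogonality condition,
and no stability under pullback enters. -/
theorem isLocal_lanSieveInclusion_iff {C D : Type} [SmallCategory C] [SmallCategory D] (F : C ⥤ D)
    (K : ∀ X : C, Sieve X → Prop) (P : Dᵒᵖ ⥤ Type) :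
    (MorphismProperty.ofHoms (lanSieveInclusion F K)).isLocal P ↔
      ∀ (X : C) (R : Sieve X), K X R → Presieve.IsSheafFor (F.op ⋙ P) R.arrows := by
  have key (i : Σ X : C, {R : Sieve X // K X R}) :
      Presieve.IsSheafFor (F.op ⋙ P) i.2.1.arrows ↔
        Function.Bijective (fun g : _ ⟶ P => lanSieveInclusion F K i ≫ g) :=
    isSheafFor_comp_iff F i.2.1 P
  refine ⟨fun h X R hR => (key ⟨X, R, hR⟩).2 (h _ (MorphismProperty.ofHoms.mk _)),
    fun h A B f hf => ?_⟩
  obtain ⟨i⟩ := hf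
  exact (key i).1 (h i.1 i.2.1 i.2.2)

theorem isWhitneyCategory_eq_isLocal (n : ℕ∞) :
    isWhitneyCategory n = (MorphismProperty.ofHoms
      (lanSieveInclusion (stratToPreStrat n) fun _ R => IsCoveringSieve R)).isLocal := by
  ext P
  exact (isLocal_lanSieveInclusion_iff _ _ P).symm

/-! ### Limits, the reflection and colimits in `Whit n` -/

instance isWhitneyCategory_isClosedUnderLimitsOfShape (n : ℕ∞) (J : Type) [SmallCategory J] :
    (isWhitneyCategory n).IsClosedUnderLimitsOfShape J := by
  -- Maps into a limit form the limit of the sets of maps, and a limit of bijections is a bijection.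
  rw [isWhitneyCategory_eq_isLocal]
  infer_instance

instance inclusion_isRightAdjoint (n : ℕ∞) : (inclusion n).IsRightAdjoint := by
  -- The source category of `ι` depends on the property, so the equality is transported by `subst`
  -- on a variable `Q`.
  have key (Q : ObjectProperty ((PreStrat n)ᵒᵖ ⥤ Type)) (hQ : Q.ι.IsRightAdjoint)
      (h : isWhitneyCategory n = Q) : (isWhitneyCategory n).ι.IsRightAdjoint := by
    subst h
    exact hQ
  refine key _ ?_ (isWhitneyCategory_eq_isLocal n)
  exact isRightAdjoint_ι_isLocal_of_isSmall _

instance hasLimits_whit (n : ℕ∞) : HasLimits (Whit n) where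
  has_limits_of_shape _ := inferInstance

instance hasColimits_whit (n : ℕ∞) : HasColimits (Whit n) :=
  haveI : Reflective (inclusion n) :=
    { L := (inclusion n).leftAdjoint, adj := Adjunction.ofIsRightAdjoint _ }
  hasColimits_of_reflective (inclusion n)

theorem isObjectwiseLimit_iff {n : ℕ∞} {J : Type} [SmallCategory J]
    {D : J ⥤ ((PreStrat n)ᵒᵖ ⥤ Type)} (c : Cone D) :
    IsObjectwiseLimit c ↔ Nonempty (IsLimit c) :=
  ⟨fun h => ⟨evaluationJointlyReflectsLimits c fun X => (h X).some⟩,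
    fun ⟨h⟩ _ => ⟨isLimitOfPreserves _ h⟩⟩

/-- The inclusion preserves limits as a right adjoint and reflects them as a fully faithful functor.
-/
theorem isLimit_iff_isObjectwiseLimit {n : ℕ∞} {J : Type} [SmallCategory J] {D : J ⥤ Whit n}
    (c : Cone D) :
    Nonempty (IsLimit c) ↔ IsObjectwiseLimit ((inclusion n).mapCone c) := by
  rw [isObjectwiseLimit_iff]
  exact ⟨fun ⟨h⟩ => ⟨isLimitOfPreserves _ h⟩, fun ⟨h⟩ => ⟨isLimitOfReflects _ h⟩⟩

/-- A left adjoint of the inclusion carries a colimit of presheaves to a colimit in `Whit_n`. -/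
def isColimitOmegaCocone {n : ℕ∞} {Om : ((PreStrat n)ᵒᵖ ⥤ Type) ⥤ Whit n}
    (adj : Om ⊣ inclusion n) {J : Type} [SmallCategory J] {D : J ⥤ Whit n}
    {c : Cocone (D ⋙ inclusion n)} (hc : IsColimit c) : IsColimit (omegaCocone adj c) where
  desc s := (adj.homEquiv c.pt s.pt).symm (hc.desc ((inclusion n).mapCocone s))
  fac s j := by
    apply ObjectProperty.hom_ext
    have h := (adj.homEquiv c.pt s.pt).apply_symm_apply (hc.desc ((inclusion n).mapCocone s))
    rw [adj.homEquiv_unit] at h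
    -- By `h`, the unit followed by the transposed map is the descent map of presheaves, so the
    -- claim reduces to `hc.fac`.
    refine (Category.assoc _ _ _).trans ((congrArg (c.ι.app j ≫ ·) h).trans ?_)
    exact hc.fac ((inclusion n).mapCocone s) j
  uniq s m hm := by
    -- Uniqueness is tested on the transpose of `m`, a map out of the presheaf colimit `c.pt`.
    refine ((adj.homEquiv c.pt s.pt).eq_symm_apply).2 ((adj.homEquiv_unit _ _ _).trans ?_)
    refine hc.uniq ((inclusion n).mapCocone s) _ fun j => ?_
    exact (Category.assoc _ _ _).symm.trans (congrArg (inclusion n).map (hm j))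

end Whitney

theorem mainTheorem10 (n : ℕ∞) :
    -- `Whit_n` is complete, and the inclusion creates the limits, which are computed objectwise
    HasLimits (Whitney.Whit n) ∧
    (∀ (J : Type) [SmallCategory J] (D : J ⥤ Whitney.Whit n),
      (∀ c : Cone (D ⋙ Whitney.inclusion n),
        Whitney.IsObjectwiseLimit c → Whitney.isWhitneyCategory n c.pt) ∧
      (∀ c : Cone D, Nonempty (IsLimit c) ↔
        Whitney.IsObjectwiseLimit ((Whitney.inclusion n).mapCone c))) ∧
    -- the inclusion has a left adjoint
    (Whitney.inclusion n).IsRightAdjoint ∧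
    -- `Whit_n` is cocomplete, with colimits given by the left adjoint of presheaf colimits
    HasColimits (Whitney.Whit n) ∧
    (∀ (Om : ((Whitney.PreStrat n)ᵒᵖ ⥤ Type) ⥤ Whitney.Whit n) (adj : Om ⊣ Whitney.inclusion n)
      (J : Type) [SmallCategory J] (D : J ⥤ Whitney.Whit n)
      (c : Cocone (D ⋙ Whitney.inclusion n)), IsColimit c →
        Nonempty (IsColimit (Whitney.omegaCocone adj c))) := by

  refine ⟨inferInstance, fun J _ D => ⟨fun c hc => ?_, Whitney.isLimit_iff_isObjectwiseLimit⟩,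
    inferInstance, inferInstance,
    fun Om adj J _ D c hc => ⟨Whitney.isColimitOmegaCocone adj hc⟩⟩
  exact ObjectProperty.prop_of_isLimit _ ((Whitney.isObjectwiseLimit_iff c).1 hc).some
    fun j => (D.obj j).property
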